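/- Let $\mathcal X$ be a finite set of units, $\mathcal G=(\mathcal X,\mathcal E)$ a directed graph, and $\alpha,\beta\in\mathbb N^{\mathcal X}$. Write $N_x=\{y : (x,y)\in\mathcal E\}$ and $N(D)=\bigcup_{x\in D}N_x$. For a matrix $W\in\mathbb N^{\mathcal X\times\mathcal X}$ put $W^x=\sum_y W_{xy}$, $W_y=\sum_x W_{xy}$, $\|W\|=\sum_{x,y}W_{xy}$. Let $\mathcal W_p$ be the (finite) set of partial allocation states, i.e. of those $W$ with $W_{xy}=0$ for $(x,y)\notin\mathcal E$, $W^x\le\alpha_x$ for all $x$ and $W_y\le\beta_y$ for all $y$, and let $\mathcal W=\{W\in\mathcal W_p : W^x=\alpha_x\ \forall x\}$ be the set of (complete) allocation states. For $W\in\mathcal W_p$, $\xi\in\{0,1\}^{\mathcal X}$ ($\xi_x=1$ means that $x$ is on) and $\bar x$ with $\xi_{\bar x}=1$, let $\mathcal W_{\bar x}(W,\xi)$ be the set of $W'\in\mathcal W_p$ with $W'\ne W$, $W'_{xy}=W_{xy}$ whenever $x\ne\bar x$ or $\xi_y=0$, and $W'^{\bar x}\ge W^{\bar x}$; and let $N_{\bar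 x}(W,\xi)=\{y\in N_{\bar x} : W_y<\beta_y,\ \xi_y=1\}$. A family of sets $\mathcal M_{\bar x}(W,\xi)\subseteq\mathcal W_{\bar x}(W,\xi)$ (for $W\in\mathcal W_p$ and $\xi_{\bar x}=1$) is admissible if (i) if $W^{\bar x}<\alpha_{\bar x}$ and $y\in N_{\bar x}(W,\xi)$, then $W+n e_{\bar xy}\in\mathcal M_{\bar x}(W,\xi)$ for some $n\in\mathbb N$; (ii) if $y'\neq y''$, $W_{\bar xy'}>0$, $\xi_{y'}=1$ and $y''\in N_{\bar x}(W,\xi)$, then $W+e_{\bar xy''}-e_{\bar xy'}\in\mathcal M_{\bar x}(W,\xi)$; (iii) for $W,W'\in\mathcal W$: $W'\in\mathcal M_{\bar x}(W,\xi)$ iff $W\in\mathcal M_{\bar x}(W',\xi)$. Fix an admissible family, utility functions $U_x:\mathcal W_p\to\mathbb R$ ($x\in\mathcal X$; no property of them is needed), $\gamma>0$, and rates $\nu^{on}_x,\nu^{off}_x,\nu^{act}_x\geq 0$. Put $Z_{\bar x}^{(W,\xi)}=\sum_{V\in\mathcal M_{\bar x}(W,\xi)}e^{\gamma U_{\bar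 x}(V)}$ and, for $W'\in\mathcal M_{\bar x}(W,\xi)$, $$P^{(W,\xi)}_{\bar x}(W')=\begin{cases}e^{\gamma U_{\bar x}(W')}/Z_{\bar x}^{(W,\xi)} & \text{if } \|W\|<\|W'\|,\\ e^{\gamma U_{\bar x}(W')}/\max\{Z_{\bar x}^{(W,\xi)},Z_{\bar x}^{(W',\xi)}\} & \text{if } \|W\|=\|W'\|,\end{cases}$$ the remaining mass being placed at $W$. Let $(W(t),\xi(t))_{t\ge0}$ be the log-linear learning process: a right-continuous continuous-time Markov chain on $\mathcal W_p\times\{0,1\}^{\mathcal X}$, with any initial law, whose transitions between distinct states are the following. Each unit $\bar x$ that is off turns on at rate $\nu^{on}_{\bar x}$; each unit $\bar x$ that is on turns off at rate $\nu^{off}_{\bar x}$; and each unit $\bar x$ that is on activates at rate $\nu^{act}_{\bar x}$, upon which $W$ is replaced by $W'$ with probability $P^{(W,\xi)}_{\bar x}(W')$, that is, $(W,\xi)$ goes to $(W',\xi)$ at rate $\nu^{act}_{\bar x}P^{(W,\xi)}_{\bar x}(W')$ for $W'\in\mathcal M_{\bar x}(W,\xi)$. Assume that 1. $\sum_{x\in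 D}\alpha_x\le\sum_{y\in N(D)}\beta_y$ for every $D\subseteq\mathcal X$; 2. $\nu^{on}_x>0$ and $\nu^{act}_x>0$ for every $x\in\mathcal X$. Then $\mathbb P(\exists t_0\ge0 : W(t)\in\mathcal W\ \ \forall t\ge t_0)=1$. -/

import Mathlib

open MeasureTheory Filter Topology
open scoped NNReal

/-- The data `(𝒢, α, β)` of the cooperative storage problem: a directed graph on the set `X` of
units (`graph.Adj x y` means that `x` may store data in `y`), the number `α x` of data atoms that
`x` has to back up, and the number `β x` of data atoms that `x` can accept. -/
structure StorageNetwork (X : Type*) where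
  graph : Digraph X
  α : X → ℕ
  β : X → ℕ

namespace StorageNetwork

variable {X : Type*} [Fintype X]

/-- `W^x`, the amount of data allocated by the user `x`. -/
def rowSum (W : Matrix X X ℕ) (x : X) : ℕ := ∑ y, W x y

/-- `W_y`, the amount of data stored in the resource `y`. -/
def colSum (W : Matrix X X ℕ) (y : X) : ℕ := ∑ x, W x y

/-- `‖W‖`, the total amount of allocated data. -/
def totalSum (W : Matrix X X ℕ) : ℕ := ∑ x, ∑ y, W x y

/-- Partial state allocations. -/
structure IsPartialAllocation (N : StorageNetwork X) (W : Matrix X X ℕ) : Prop where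
  graph_constraint : ∀ x y, ¬ N.graph.Adj x y → W x y = 0
  row_le : ∀ x, rowSum W x ≤ N.α x
  col_le : ∀ y, colSum W y ≤ N.β y

/-- The set `𝒲_p` of partial state allocations. -/
def PartialAllocation (N : StorageNetwork X) : Type _ :=
  {W : Matrix X X ℕ // N.IsPartialAllocation W}

/-- Membership in the set `𝒲` of (complete) allocation states. -/
def PartialAllocation.IsComplete {N : StorageNetwork X} (W : N.PartialAllocation) : Prop :=
  ∀ x, rowSum W.1 x = N.α x

instance (N : StorageNetwork X) : Finite N.PartialAllocation := by
  classical
  have hinj : Function.Injective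
      (fun (W : N.PartialAllocation) (x y : X) =>
        (⟨W.1 x y, Nat.lt_succ_of_le
          ((Finset.single_le_sum (f := fun z => W.1 x z) (fun _ _ => Nat.zero_le _)
            (Finset.mem_univ y)).trans (W.2.row_le x))⟩ : Fin (N.α x + 1))) := by
    intro W W' h
    apply Subtype.ext
    ext x y
    have := congrFun (congrFun h x) y
    simpa using congrArg Fin.val this
  exact Finite.of_injective _ hinj

noncomputable instance (N : StorageNetwork X) : Fintype N.PartialAllocation := Fintype.ofFinite _

noncomputable instance (N : StorageNetwork X) : DecidableEq N.PartialAllocation :=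
  Classical.decEq _

open Classical in
/-- `N(D)`, the set of all resources available to some unit of `D`. -/
noncomputable def outNeighbors (N : StorageNetwork X) (D : Finset X) : Finset X :=
  {y | ∃ x ∈ D, N.graph.Adj x y}

/-- The existence condition: `∑_{x ∈ D} α_x ≤ ∑_{y ∈ N(D)} β_y` for every set `D` of units. -/
def ExistenceCondition (N : StorageNetwork X) : Prop :=
  ∀ D : Finset X, ∑ x ∈ D, N.α x ≤ ∑ y ∈ N.outNeighbors D, N.β y

/-- `W' ∈ 𝒲_x(W, ξ)`: the state `W'` is obtained from `W` by a modification made by the unit `x`,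
which changes only entries `W x y` with `y` on and does not decrease the data allocated by `x`. -/
structure IsModification (N : StorageNetwork X) (x : X) (W : N.PartialAllocation) (ξ : X → Bool)
    (W' : N.PartialAllocation) : Prop where
  eq_of_ne : ∀ z y, z ≠ x → W'.1 z y = W.1 z y
  eq_of_off : ∀ z y, ξ y = false → W'.1 z y = W.1 z y
  row_le : rowSum W.1 x ≤ rowSum W'.1 x
  ne : W' ≠ W

/-- `y ∈ N_x(W, ξ)`: the resource `y` is an out-neighbor of `x`, is on and still has space. -/
def IsAvailable (N : StorageNetwork X) (x : X) (W : N.PartialAllocation) (ξ : X → Bool)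
    (y : X) : Prop :=
  N.graph.Adj x y ∧ colSum W.1 y < N.β y ∧ ξ y = true

/-- Admissible families `M x W ξ ⊆ 𝒲_x(W, ξ)`. Only units that are on can activate, so nothing is
required of `M x W ξ` when `x` is off. `Matrix.single x y n` is the matrix `n e_{xy}`. -/
structure IsAdmissible [DecidableEq X] (N : StorageNetwork X)
    (M : X → N.PartialAllocation → (X → Bool) → Finset N.PartialAllocation) : Prop where
  subset : ∀ x W ξ, ξ x = true → ∀ W' ∈ M x W ξ, N.IsModification x W ξ W'
  /-- new data can be allocated in any available resource -/
  allocate : ∀ x W ξ, ξ x = true → rowSum W.1 x < N.α x → ∀ y, N.IsAvailable x W ξ y →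
    ∃ n : ℕ, ∃ W' ∈ M x W ξ, W'.1 = W.1 + Matrix.single x y n
  /-- `W + e_{xy''} - e_{xy'}` belongs to `M x W ξ` (written without subtraction) -/
  transfer : ∀ x W ξ, ξ x = true → ∀ y' y'', y' ≠ y'' → 0 < W.1 x y' → ξ y' = true →
    N.IsAvailable x W ξ y'' →
    ∃ W' ∈ M x W ξ, W'.1 + Matrix.single x y' 1 = W.1 + Matrix.single x y'' 1
  /-- moves between complete allocation states can be reversed -/
  reversible : ∀ x ξ, ξ x = true → ∀ W W' : N.PartialAllocation, W.IsComplete → W'.IsComplete →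
    (W' ∈ M x W ξ ↔ W ∈ M x W' ξ)

section Dynamics

variable (N : StorageNetwork X) (U : X → N.PartialAllocation → ℝ) (γ : ℝ)
  (M : X → N.PartialAllocation → (X → Bool) → Finset N.PartialAllocation)

/-- The partition function `Z_x^{(W, ξ)}(γ)`. -/
noncomputable def partition (x : X) (W : N.PartialAllocation) (ξ : X → Bool) : ℝ :=
  ∑ V ∈ M x W ξ, Real.exp (γ * U x V)

/-- The Gibbs probability `P_x^{(W, ξ)}(W')` of a move from `W` to a state `W' ∈ M x W ξ`. -/
noncomputable def gibbsWeight (x : X) (W : N.PartialAllocation) (ξ : X → Bool)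
    (W' : N.PartialAllocation) : ℝ :=
  if totalSum W.1 < totalSum W'.1 then
    Real.exp (γ * U x W') / N.partition U γ M x W ξ
  else
    Real.exp (γ * U x W') / max (N.partition U γ M x W ξ) (N.partition U γ M x W' ξ)

/-- The probability distribution `P_x^{(W, ξ)}` on `𝒲_p` of the state chosen by the unit `x` when
it activates: the Gibbs weights on `M x W ξ`, and the remaining mass at `W`. -/
noncomputable def activationProb (x : X) (W : N.PartialAllocation) (ξ : X → Bool)
    (W' : N.PartialAllocation) : ℝ :=
  if W' ∈ M x W ξ then N.gibbsWeight U γ M x W ξ W'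
  else if W' = W then 1 - ∑ V ∈ M x W ξ, N.gibbsWeight U γ M x W ξ V
  else 0

/-- States `(W, ξ)` of the augmented process. -/
abbrev State : Type _ := N.PartialAllocation × (X → Bool)

variable [DecidableEq X] (νon νoff νact : X → ℝ)

/-- The rate at which the augmented process goes from `s = (W, ξ)` to another state
`s' = (W', ξ')`: a unit `x` that is off is turned on at rate `νon x`, a unit that is on is turned
off at rate `νoff x`, and a unit that is on activates at rate `νact x` and then chooses the new
allocation with the probabilities `activationProb`. -/
noncomputable def rate (s s' : N.State) : ℝ :=
  ∑ x,
    ((if s.2 x = false ∧ s'.1 = s.1 ∧ s'.2 = Function.update s.2 x true then νon x else 0)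
      + (if s.2 x = true ∧ s'.1 = s.1 ∧ s'.2 = Function.update s.2 x false then νoff x else 0)
      + (if s.2 x = true ∧ s'.2 = s.2 then
          νact x * N.activationProb U γ M x s.1 s.2 s'.1 else 0))

/-- The generator (`Q`-matrix) of the augmented process `(W(t), ξ(t))`. -/
noncomputable def generator : Matrix N.State N.State ℝ := fun s s' =>
  if s' = s then -∑ u ∈ Finset.univ.erase s, N.rate U γ M νon νoff νact s u
  else N.rate U γ M νon νoff νact s s'

end Dynamics

end StorageNetwork

/-- `Y` is a continuous-time Markov chain on the finite set `S` with generator `Q` (and arbitrary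
initial law): it has almost surely right-continuous paths, and its transition matrices are
`P(t) = exp (t Q)`, that is,
`ℙ(Y_{t₀} = s₀, …, Y_{tₙ} = sₙ) = ℙ(Y_{t₀} = s₀) ∏ₖ P(tₖ₊₁ - tₖ)(sₖ, sₖ₊₁)` for `t₀ ≤ … ≤ tₙ`. -/
structure IsContinuousTimeMarkovChain {S : Type*} [Fintype S] [DecidableEq S]
    {Ω : Type*} [MeasurableSpace Ω] (μ : Measure Ω) (Q : Matrix S S ℝ) (Y : ℝ≥0 → Ω → S) :
    Prop where
  measurable : ∀ t s, MeasurableSet {ω | Y t ω = s}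
  right_continuous : ∀ᵐ ω ∂μ, ∀ t : ℝ≥0, ∀ᶠ u in 𝓝[>] t, Y u ω = Y t ω
  law : ∀ (n : ℕ) (t : Fin (n + 1) → ℝ≥0), Monotone t → ∀ s : Fin (n + 1) → S,
    μ.real {ω | ∀ k, Y (t k) ω = s k} =
      μ.real {ω | Y (t 0) ω = s 0} *
        ∏ k : Fin n, NormedSpace.exp (((t k.succ : ℝ) - (t k.castSucc : ℝ)) • Q)
          (s k.castSucc) (s k.succ)

/-! Complete allocations form a closed class: switching leaves `W` alone, and an activation cannot
lower the active unit's row sum or alter other rows. The class is accessible from every state: turn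
all units on, then raise `‖W‖` step by step. If `W` is incomplete, some under-allocated unit has an
out-neighbor in which a chain of transfers makes room; otherwise the units that reach no such
resource would violate the existence condition, as in Hall's theorem
(`ExistenceCondition.exists_adj_augmentable`, `IsAdmissible.exists_totalSum_lt`). A finite chain is
absorbed by such a class: over unit time it is entered with probability bounded below, so the mass
outside decays geometrically (`Matrix.exists_sum_compl_exp_nsmul_le`), and right-continuity extends
the conclusion to all times (`ae_eventually_mem`). -/

/-! ### Positivity, support and row sums of matrix exponentials -/

section MatrixExponential

variable {S : Type*} [Fintype S] [DecidableEq S]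

theorem Matrix.hasSum_exp_apply (A : Matrix S S ℝ) (i j : S) :
    HasSum (fun n : ℕ => (n.factorial : ℝ)⁻¹ * (A ^ n) i j) (NormedSpace.exp A i j) := by
  let _ : NormedRing (Matrix S S ℝ) := Matrix.linftyOpNormedRing
  let _ : NormedAlgebra ℝ (Matrix S S ℝ) := Matrix.linftyOpNormedAlgebra
  have h := NormedSpace.exp_series_hasSum_exp' (𝕂 := ℝ) A
  exact Pi.hasSum.1 (Pi.hasSum.1 h i) j

theorem Matrix.exists_pow_apply_pos {A : Matrix S S ℝ} (hA : ∀ i j, 0 ≤ A i j) {i j : S}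
    (h : Relation.ReflTransGen (fun i j => 0 < A i j) i j) : ∃ n : ℕ, 0 < (A ^ n) i j := by
  induction h with
  | refl => exact ⟨0, by simp⟩
  | @tail k l _ hkl ih =>
    obtain ⟨n, hn⟩ := ih
    refine ⟨n + 1, ?_⟩
    rw [pow_succ, Matrix.mul_apply]
    exact Finset.sum_pos' (fun m _ => mul_nonneg (pow_apply_nonneg hA n i m) (hA m l))
      ⟨k, Finset.mem_univ k, mul_pos hn hkl⟩

/-- The exponential of a matrix is that of a diagonal shift of it, up to a scalar. -/
theorem Matrix.exp_apply_eq_exp_mul_exp_add (A : Matrix S S ℝ) (c : ℝ) (i j : S) :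
    NormedSpace.exp A i j = Real.exp (-c) * NormedSpace.exp (A + c • (1 : Matrix S S ℝ)) i j := by
  have hA : A = (A + c • (1 : Matrix S S ℝ)) + Matrix.diagonal (fun _ => -c) := by
    have : Matrix.diagonal (fun _ : S => -c) = -(c • (1 : Matrix S S ℝ)) := by
      rw [Matrix.smul_one_eq_diagonal, Matrix.diagonal_neg]
    rw [this]
    abel
  have hcomm : Commute (A + c • (1 : Matrix S S ℝ)) (Matrix.diagonal (fun _ => -c)) := by
    rw [← Matrix.smul_one_eq_diagonal]
    exact (Commute.one_right _).smul_right _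
  conv_lhs => rw [hA]
  rw [Matrix.exp_add_of_commute _ _ hcomm, Matrix.exp_diagonal, Matrix.mul_diagonal, mul_comm]
  congr 1
  rw [Pi.exp_def, Real.exp_eq_exp_ℝ]

theorem Matrix.exp_apply_nonneg_of_nonneg {A : Matrix S S ℝ} (hA : ∀ i j, 0 ≤ A i j) (i j : S) :
    0 ≤ NormedSpace.exp A i j :=
  (hasSum_exp_apply A i j).nonneg fun n => mul_nonneg (by positivity) (pow_apply_nonneg hA n i j)

theorem Matrix.exp_apply_pos_of_nonneg {A : Matrix S S ℝ} (hA : ∀ i j, 0 ≤ A i j) {i j : S}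
    (h : Relation.ReflTransGen (fun i j => 0 < A i j) i j) : 0 < NormedSpace.exp A i j := by
  obtain ⟨n, hn⟩ := exists_pow_apply_pos hA h
  refine lt_of_lt_of_le (mul_pos (by positivity) hn)
    (le_hasSum (hasSum_exp_apply A i j) n fun m _ => mul_nonneg (by positivity) ?_)
  exact pow_apply_nonneg hA m i j

/-- A large multiple of the identity absorbs the negative diagonal and keeps every positive edge, so
sign questions about `exp Q` reduce to nonnegative matrices. -/
theorem Matrix.exists_nonneg_add_smul_one {Q : Matrix S S ℝ} (hQ : ∀ i j, i ≠ j → 0 ≤ Q i j) :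
    ∃ c : ℝ, ∀ i j, 0 ≤ (Q + c • (1 : Matrix S S ℝ)) i j ∧
      Q i j ≤ (Q + c • (1 : Matrix S S ℝ)) i j := by
  refine ⟨∑ i, |Q i i|, fun i j => ?_⟩
  have hc : |Q i i| ≤ ∑ i, |Q i i| :=
    Finset.single_le_sum (f := fun i => |Q i i|) (fun _ _ => abs_nonneg _) (Finset.mem_univ i)
  rcases eq_or_ne i j with rfl | hij
  · simp only [Matrix.add_apply, Matrix.smul_apply, Matrix.one_apply_eq, smul_eq_mul, mul_one]
    constructor <;> linarith [neg_abs_le (Q i i), abs_nonneg (Q i i)]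
  · simp [Matrix.one_apply_ne hij, hQ i j hij]

theorem Matrix.exp_apply_nonneg {Q : Matrix S S ℝ} (hQ : ∀ i j, i ≠ j → 0 ≤ Q i j) (i j : S) :
    0 ≤ NormedSpace.exp Q i j := by
  obtain ⟨c, hc⟩ := exists_nonneg_add_smul_one hQ
  rw [exp_apply_eq_exp_mul_exp_add Q c]
  exact mul_nonneg (Real.exp_pos _).le (exp_apply_nonneg_of_nonneg (fun i j => (hc i j).1) i j)

theorem Matrix.exp_apply_pos {Q : Matrix S S ℝ} (hQ : ∀ i j, i ≠ j → 0 ≤ Q i j) {i j : S}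
    (h : Relation.ReflTransGen (fun i j => 0 < Q i j) i j) : 0 < NormedSpace.exp Q i j := by
  obtain ⟨c, hc⟩ := exists_nonneg_add_smul_one hQ
  rw [exp_apply_eq_exp_mul_exp_add Q c]
  refine mul_pos (Real.exp_pos _) (exp_apply_pos_of_nonneg (fun i j => (hc i j).1) ?_)
  exact Relation.ReflTransGen.mono (fun i j hij => lt_of_lt_of_le hij (hc i j).2) _ _ h

theorem Matrix.pow_apply_eq_zero_of_mem_of_notMem {A : Matrix S S ℝ} {C : Finset S}
    (hA : ∀ i ∈ C, ∀ j ∉ C, A i j = 0) (n : ℕ) {i j : S} (hi : i ∈ C) (hj : j ∉ C) :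
    (A ^ n) i j = 0 := by
  induction n generalizing j with
  | zero => rw [pow_zero, Matrix.one_apply_ne]; rintro rfl; exact hj hi
  | succ n ih =>
    rw [pow_succ, Matrix.mul_apply]
    refine Finset.sum_eq_zero fun k _ => ?_
    by_cases hk : k ∈ C
    · rw [hA k hk j hj, mul_zero]
    · rw [ih hk, zero_mul]

theorem Matrix.exp_apply_eq_zero_of_mem_of_notMem {A : Matrix S S ℝ} {C : Finset S}
    (hA : ∀ i ∈ C, ∀ j ∉ C, A i j = 0) {i j : S} (hi : i ∈ C) (hj : j ∉ C) :
    NormedSpace.exp A i j = 0 := by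
  have h := hasSum_exp_apply A i j
  simp only [pow_apply_eq_zero_of_mem_of_notMem hA _ hi hj, mul_zero] at h
  exact h.unique hasSum_zero

/-- `Q` kills the constant vector, hence so does every positive power; only the identity term of the
series contributes. -/
theorem Matrix.sum_exp_apply {Q : Matrix S S ℝ} (hQ : ∀ i, ∑ j, Q i j = 0) (i : S) :
    ∑ j, NormedSpace.exp Q i j = 1 := by
  have hpow : ∀ n : ℕ, ∑ j, (Q ^ (n + 1)) i j = 0 := fun n => by
    simp only [pow_succ, Matrix.mul_apply]
    rw [Finset.sum_comm]
    simp only [← Finset.mul_sum, hQ, mul_zero, Finset.sum_const_zero]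
  have h := hasSum_sum fun j (_ : j ∈ Finset.univ) => hasSum_exp_apply Q i j
  refine h.unique ?_
  convert hasSum_single (f := fun n : ℕ => ∑ j, (n.factorial : ℝ)⁻¹ * (Q ^ n) i j) 0 ?_ using 1
  · simp [Matrix.one_apply]
  · rintro (_ | n) hn
    · exact absurd rfl hn
    · rw [← Finset.mul_sum, hpow, mul_zero]

/-- If `C` is closed and accessible from every state, then the mass that `exp (n Q)` puts outside
`C` decays geometrically. -/
theorem Matrix.exists_sum_compl_exp_nsmul_le {Q : Matrix S S ℝ} {C : Finset S}
    (hQ : ∀ i j, i ≠ j → 0 ≤ Q i j) (hrow : ∀ i, ∑ j, Q i j = 0)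
    (hclosed : ∀ i ∈ C, ∀ j ∉ C, Q i j = 0)
    (hacc : ∀ i, ∃ j ∈ C, Relation.ReflTransGen (fun i j => 0 < Q i j) i j) :
    ∃ r : ℝ, 0 ≤ r ∧ r < 1 ∧ ∀ (n : ℕ) (i : S),
      ∑ j ∈ Cᶜ, NormedSpace.exp (n • Q) i j ≤ r ^ n := by
  have hlt : ∀ i, ∑ j ∈ Cᶜ, NormedSpace.exp Q i j < 1 := fun i => by
    obtain ⟨j, hj, hij⟩ := hacc i
    have hpos : 0 < ∑ j ∈ C, NormedSpace.exp Q i j :=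
      Finset.sum_pos' (fun k _ => exp_apply_nonneg hQ i k) ⟨j, hj, exp_apply_pos hQ hij⟩
    have hsum := Finset.sum_add_sum_compl C fun j => NormedSpace.exp Q i j
    rw [sum_exp_apply hrow] at hsum
    linarith
  obtain ⟨r, hr0, hr1, hr⟩ : ∃ r : ℝ, 0 ≤ r ∧ r < 1 ∧
      ∀ i, ∑ j ∈ Cᶜ, NormedSpace.exp Q i j ≤ r := by
    -- Finiteness of `S` turns the pointwise strict bounds into a uniform one.
    rcases isEmpty_or_nonempty S with hS | hS
    · exact ⟨0, le_rfl, one_pos, fun i => (hS.false i).elim⟩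
    · obtain ⟨i₀, hi₀⟩ := Finite.exists_max fun i => ∑ j ∈ Cᶜ, NormedSpace.exp Q i j
      exact ⟨_, Finset.sum_nonneg fun k _ => exp_apply_nonneg hQ i₀ k, hlt i₀, hi₀⟩
  refine ⟨r, hr0, hr1, fun n => ?_⟩
  induction n with
  | zero =>
    intro i
    rw [zero_smul, NormedSpace.exp_zero, pow_zero]
    calc ∑ j ∈ Cᶜ, (1 : Matrix S S ℝ) i j ≤ ∑ j, (1 : Matrix S S ℝ) i j := by
          refine Finset.sum_le_sum_of_subset_of_nonneg (Finset.subset_univ _) fun j _ _ => ?_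
          rw [Matrix.one_apply]; split_ifs <;> norm_num
      _ = 1 := by simp [Matrix.one_apply]
  | succ n ih =>
    intro i
    -- Conditioning on the state after the first unit of time: from `C` no mass escapes, so only the
    -- mass still outside counts.
    have hstep : ∀ k, ∑ j ∈ Cᶜ, NormedSpace.exp (n • Q) k j ≤ if k ∈ C then 0 else r ^ n := by
      intro k
      split_ifs with hk
      · refine (Finset.sum_eq_zero fun j hj => ?_).le
        refine exp_apply_eq_zero_of_mem_of_notMem (C := C) ?_ hk (Finset.mem_compl.1 hj)
        intro a ha b hb
        rw [Matrix.smul_apply, hclosed a ha b hb, smul_zero]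
      · exact ih k
    have hexp : NormedSpace.exp ((n + 1) • Q) = NormedSpace.exp Q * NormedSpace.exp (n • Q) := by
      rw [Matrix.exp_nsmul, Matrix.exp_nsmul, pow_succ']
    calc ∑ j ∈ Cᶜ, NormedSpace.exp ((n + 1) • Q) i j
        = ∑ k, NormedSpace.exp Q i k * ∑ j ∈ Cᶜ, NormedSpace.exp (n • Q) k j := by
          simp only [hexp, Matrix.mul_apply, Finset.mul_sum]
          rw [Finset.sum_comm]
      _ ≤ ∑ k, NormedSpace.exp Q i k * (if k ∈ C then 0 else r ^ n) :=
          Finset.sum_le_sum fun k _ =>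
            mul_le_mul_of_nonneg_left (hstep k) (exp_apply_nonneg hQ i k)
      _ = (∑ k ∈ Cᶜ, NormedSpace.exp Q i k) * r ^ n := by
          rw [Finset.sum_mul, ← Finset.sum_add_sum_compl C]
          rw [Finset.sum_eq_zero fun k hk => by rw [if_pos hk, mul_zero], zero_add]
          exact Finset.sum_congr rfl fun k hk => by rw [if_neg (Finset.mem_compl.1 hk)]
      _ ≤ r * r ^ n := mul_le_mul_of_nonneg_right (hr i) (pow_nonneg hr0 n)
      _ = r ^ (n + 1) := (pow_succ' r n).symm

end MatrixExponential

/-! ### Absorption of a finite Markov chain -/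

namespace IsContinuousTimeMarkovChain

variable {S : Type*} [Fintype S] [DecidableEq S] {Ω : Type*} [MeasurableSpace Ω]
  {μ : Measure Ω} {Q : Matrix S S ℝ} {Y : ℝ≥0 → Ω → S}

theorem measureReal_pair (h : IsContinuousTimeMarkovChain μ Q Y) {a b : ℝ≥0} (hab : a ≤ b)
    (i j : S) :
    μ.real {ω | Y a ω = i ∧ Y b ω = j} =
      μ.real {ω | Y a ω = i} * NormedSpace.exp (((b : ℝ) - (a : ℝ)) • Q) i j := by
  have hmono : Monotone ![a, b] := by
    rw [Fin.monotone_iff_le_succ]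
    intro k
    fin_cases k
    simpa using hab
  simpa [Fin.forall_fin_two] using h.law 1 ![a, b] hmono ![i, j]

theorem ae_mem_of_mem [IsFiniteMeasure μ] (h : IsContinuousTimeMarkovChain μ Q Y) {C : Finset S}
    (hclosed : ∀ i ∈ C, ∀ j ∉ C, Q i j = 0) {a b : ℝ≥0} (hab : a ≤ b) :
    ∀ᵐ ω ∂μ, Y a ω ∈ C → Y b ω ∈ C := by
  have hnull : ∀ i ∈ C, ∀ j ∉ C, ∀ᵐ ω ∂μ, ¬ (Y a ω = i ∧ Y b ω = j) := by
    intro i hi j hj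
    have hexp : NormedSpace.exp (((b : ℝ) - (a : ℝ)) • Q) i j = 0 :=
      Matrix.exp_apply_eq_zero_of_mem_of_notMem
        (fun k hk l hl => by rw [Matrix.smul_apply, hclosed k hk l hl, smul_zero]) hi hj
    have := h.measureReal_pair hab i j
    rw [hexp, mul_zero, measureReal_eq_zero_iff] at this
    rw [ae_iff]
    simpa using this
  have hall : ∀ᵐ ω ∂μ, ∀ i j, i ∈ C → j ∉ C → ¬ (Y a ω = i ∧ Y b ω = j) := by
    simp only [ae_all_iff]
    exact fun i j hi hj => hnull i hi j hj
  filter_upwards [hall] with ω hω ha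
  by_contra hb
  exact hω _ _ ha hb ⟨rfl, rfl⟩

/-- Union bound over initial and final states; bounding each initial probability by `1` costs the
factor `card S`, harmless against geometric decay. -/
theorem measureReal_notMem_le [IsProbabilityMeasure μ] (h : IsContinuousTimeMarkovChain μ Q Y)
    {C : Finset S} {r : ℝ} (n : ℕ) (hQ : ∀ i j, i ≠ j → 0 ≤ Q i j)
    (hr : ∀ i, ∑ j ∈ Cᶜ, NormedSpace.exp (n • Q) i j ≤ r) :
    μ.real {ω | Y n ω ∉ C} ≤ Fintype.card S * r := by
  have hexp : ((((n : ℝ≥0) : ℝ) - ((0 : ℝ≥0) : ℝ)) • Q) = n • Q := by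
    rw [NNReal.coe_zero, sub_zero, NNReal.coe_natCast, Nat.cast_smul_eq_nsmul]
  have hnonneg : ∀ i j, 0 ≤ NormedSpace.exp (n • Q) i j := fun i j =>
    Matrix.exp_apply_nonneg (fun k l hkl => by
      rw [Matrix.smul_apply]; exact nsmul_nonneg (hQ k l hkl) n) i j
  calc μ.real {ω | Y n ω ∉ C}
      ≤ μ.real (⋃ i ∈ (Finset.univ : Finset S), ⋃ j ∈ Cᶜ, {ω | Y 0 ω = i ∧ Y n ω = j}) := by
        refine measureReal_mono (fun ω hω => ?_) (measure_ne_top _ _)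
        simpa using hω
    _ ≤ ∑ i, μ.real (⋃ j ∈ Cᶜ, {ω | Y 0 ω = i ∧ Y n ω = j}) :=
        measureReal_biUnion_finset_le _ _
    _ ≤ ∑ i, ∑ j ∈ Cᶜ, μ.real {ω | Y 0 ω = i ∧ Y n ω = j} :=
        Finset.sum_le_sum fun i _ => measureReal_biUnion_finset_le _ _
    _ = ∑ i, μ.real {ω | Y 0 ω = i} * ∑ j ∈ Cᶜ, NormedSpace.exp (n • Q) i j := by
        refine Finset.sum_congr rfl fun i _ => ?_
        rw [Finset.mul_sum]
        refine Finset.sum_congr rfl fun j _ => ?_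
        rw [h.measureReal_pair zero_le, hexp]
    _ ≤ ∑ _i : S, r := by
        refine Finset.sum_le_sum fun i _ => ?_
        refine le_trans (mul_le_of_le_one_left ?_ measureReal_le_one) (hr i)
        exact Finset.sum_nonneg fun j _ => hnonneg i j
    _ = Fintype.card S * r := by rw [Finset.sum_const, nsmul_eq_mul, Finset.card_univ]

/-- A continuous-time Markov chain on a finite set is almost surely absorbed by any closed set that
is accessible from every state. -/
theorem ae_eventually_mem [IsProbabilityMeasure μ] (h : IsContinuousTimeMarkovChain μ Q Y)
    {C : Finset S} (hQ : ∀ i j, i ≠ j → 0 ≤ Q i j) (hrow : ∀ i, ∑ j, Q i j = 0)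
    (hclosed : ∀ i ∈ C, ∀ j ∉ C, Q i j = 0)
    (hacc : ∀ i, ∃ j ∈ C, Relation.ReflTransGen (fun i j => 0 < Q i j) i j) :
    ∀ᵐ ω ∂μ, ∃ t₀ : ℝ≥0, ∀ t ≥ t₀, Y t ω ∈ C := by
  obtain ⟨r, hr0, hr1, hr⟩ := Matrix.exists_sum_compl_exp_nsmul_le hQ hrow hclosed hacc
  have hhit : ∀ᵐ ω ∂μ, ∃ n : ℕ, Y n ω ∈ C := by
    have hzero : μ.real {ω | ∀ n : ℕ, Y n ω ∉ C} ≤ 0 := by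
      have hlim : Tendsto (fun n : ℕ => (Fintype.card S : ℝ) * r ^ n) atTop (𝓝 0) := by
        simpa using (tendsto_pow_atTop_nhds_zero_of_lt_one hr0 hr1).const_mul (Fintype.card S : ℝ)
      refine ge_of_tendsto' hlim fun n => ?_
      exact (measureReal_mono (Set.ofPred_subset_ofPred.2 fun ω hω => hω n)).trans (h.measureReal_notMem_le n hQ (hr n))
    rw [ae_iff]
    have := le_antisymm hzero measureReal_nonneg
    rw [measureReal_eq_zero_iff] at this
    simpa using this
  -- Closedness holds almost surely for each pair of times; a countable dense set of times gives one
  -- common null set.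
  obtain ⟨D, hDc, hD⟩ := TopologicalSpace.exists_countable_dense ℝ≥0
  have hstay : ∀ᵐ ω ∂μ, ∀ n : ℕ, ∀ q ∈ D, (n : ℝ≥0) ≤ q → Y n ω ∈ C → Y q ω ∈ C := by
    rw [ae_all_iff]
    intro n
    rw [ae_ball_iff hDc]
    intro q _
    by_cases hnq : (n : ℝ≥0) ≤ q
    · filter_upwards [h.ae_mem_of_mem hclosed hnq] with ω hω _ using hω
    · exact Eventually.of_forall fun ω hle => absurd hle hnq
  filter_upwards [hhit, hstay, h.right_continuous] with ω ⟨n, hn⟩ hω hright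
  refine ⟨n, fun t ht => ?_⟩
  -- The path equals `Y t ω` just to the right of `t`, and some `q` in `D` lies there.
  obtain ⟨u, htu, hu⟩ := (mem_nhdsGT_iff_exists_Ioo_subset (a := t)).1 (hright t)
  obtain ⟨q, hqD, hq⟩ := hD.exists_mem_open isOpen_Ioo (Set.nonempty_Ioo.2 htu)
  have hYq : Y q ω = Y t ω := hu hq
  rw [← hYq]
  exact hω n q hqD (ht.trans hq.1.le) hn

end IsContinuousTimeMarkovChain

/-! ### Augmenting transfers towards a complete allocation -/

namespace StorageNetwork

section Sums

variable {X : Type*} [Fintype X]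

theorem rowSum_add (A B : Matrix X X ℕ) (x : X) : rowSum (A + B) x = rowSum A x + rowSum B x :=
  Finset.sum_add_distrib

theorem colSum_add (A B : Matrix X X ℕ) (y : X) : colSum (A + B) y = colSum A y + colSum B y :=
  Finset.sum_add_distrib

theorem totalSum_eq_sum_rowSum (A : Matrix X X ℕ) : totalSum A = ∑ x, rowSum A x := rfl

variable [DecidableEq X]

theorem rowSum_single (x y : X) (n : ℕ) (z : X) :
    rowSum (Matrix.single x y n) z = if x = z then n else 0 := by
  by_cases h : x = z <;> simp [rowSum, Matrix.single_apply, h]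

theorem colSum_single (x y : X) (n : ℕ) (z : X) :
    colSum (Matrix.single x y n) z = if y = z then n else 0 := by
  by_cases h : y = z <;> simp [colSum, Matrix.single_apply, h]

end Sums

section Augmentation

variable {X : Type*} [Fintype X]

/-- The resources in which space can be made by at most `n` successive transfers of data. -/
def augmentable (N : StorageNetwork X) (W : Matrix X X ℕ) : ℕ → Set X
  | 0 => {y | colSum W y < N.β y}
  | n + 1 => {y | y ∈ augmentable N W n ∨
      ∃ x, ∃ z ∈ augmentable N W n, N.graph.Adj x z ∧ 0 < W x y}

variable {N : StorageNetwork X}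

theorem PartialAllocation.exists_rowSum_lt {W : N.PartialAllocation} (hW : ¬ W.IsComplete) :
    ∃ x, rowSum W.1 x < N.α x := by
  obtain ⟨x, hx⟩ := not_forall.1 hW
  exact ⟨x, lt_of_le_of_ne (W.2.row_le x) hx⟩

/-- Under the existence condition, some unit with data left to allocate has an out-neighbor in
which space can be made. -/
theorem ExistenceCondition.exists_adj_augmentable (hN : N.ExistenceCondition)
    {W : N.PartialAllocation} (hW : ¬ W.IsComplete) :
    ∃ x y n, rowSum W.1 x < N.α x ∧ N.graph.Adj x y ∧ y ∈ N.augmentable W.1 n := by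
  classical
  by_contra! hcon
  obtain ⟨x₀, hx₀⟩ := W.exists_rowSum_lt hW
  -- The candidate violator: units none of whose out-neighbors can be given space.
  set D : Finset X := {x | ∀ y, N.graph.Adj x y → ∀ n, y ∉ N.augmentable W.1 n} with hD
  have hmem : ∀ x, x ∈ D ↔ ∀ y, N.graph.Adj x y → ∀ n, y ∉ N.augmentable W.1 n := by simp [hD]
  have hx₀D : x₀ ∈ D := (hmem x₀).2 fun y hy n => hcon x₀ y n hx₀ hy
  have hout : ∀ y ∈ N.outNeighbors D, ∀ n, y ∉ N.augmentable W.1 n := by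
    intro y hy
    obtain ⟨x, hx, hxy⟩ : ∃ x ∈ D, N.graph.Adj x y := by simpa [outNeighbors] using hy
    exact (hmem x).1 hx y hxy
  have hcol : ∀ y ∈ N.outNeighbors D, N.β y ≤ ∑ x ∈ D, W.1 x y := by
    intro y hy
    -- A unit outside `D` with data in `y` could move some to an augmentable resource, making `y`
    -- augmentable one level up.
    have hsub : ∑ x ∈ D, W.1 x y = colSum W.1 y := by
      refine Finset.sum_subset (Finset.subset_univ D) fun x _ hx => ?_
      rw [hmem] at hx
      push Not at hx
      obtain ⟨z, hxz, n, hz⟩ := hx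
      by_contra hne
      exact hout y hy (n + 1) (Or.inr ⟨x, z, hz, hxz, Nat.pos_of_ne_zero hne⟩)
    rw [hsub]
    exact not_lt.1 (hout y hy 0)
  have hlt : ∑ x ∈ D, rowSum W.1 x < ∑ x ∈ D, N.α x :=
    Finset.sum_lt_sum (fun x _ => W.2.row_le x) ⟨x₀, hx₀D, hx₀⟩
  have hle : ∑ x ∈ D, N.α x ≤ ∑ x ∈ D, rowSum W.1 x :=
    calc ∑ x ∈ D, N.α x ≤ ∑ y ∈ N.outNeighbors D, N.β y := hN D
      _ ≤ ∑ y ∈ N.outNeighbors D, ∑ x ∈ D, W.1 x y := Finset.sum_le_sum hcol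
      _ = ∑ x ∈ D, ∑ y ∈ N.outNeighbors D, W.1 x y := Finset.sum_comm
      _ ≤ ∑ x ∈ D, rowSum W.1 x :=
          Finset.sum_le_sum fun x _ => Finset.sum_le_sum_of_subset (Finset.subset_univ _)
  exact absurd hlt hle.not_gt

theorem IsModification.isComplete {x : X} {W W' : N.PartialAllocation} {ξ : X → Bool}
    (h : N.IsModification x W ξ W') (hW : W.IsComplete) : W'.IsComplete := by
  intro z
  rcases eq_or_ne z x with rfl | hz
  · exact le_antisymm (W'.2.row_le z) ((hW z).symm.le.trans h.row_le)
  · rw [← hW z]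
    exact Finset.sum_congr rfl fun y _ => h.eq_of_ne z y hz

variable [DecidableEq X] {M : X → N.PartialAllocation → (X → Bool) → Finset N.PartialAllocation}

/-- While all units are on, space can be made by transfers in any augmentable resource. -/
theorem IsAdmissible.exists_colSum_lt (hM : N.IsAdmissible M) (W : N.PartialAllocation) (n : ℕ)
    {y : X} (hy : y ∈ N.augmentable W.1 n) :
    ∃ W' : N.PartialAllocation,
      Relation.ReflTransGen (fun V V' => ∃ x, V' ∈ M x V fun _ => true) W W' ∧
      (∀ x, rowSum W'.1 x = rowSum W.1 x) ∧ colSum W'.1 y < N.β y ∧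
      -- This strengthens the induction: making room at level `n` leaves the data in a level `n + 1`
      -- resource intact, so it is still there to be transferred.
      ∀ z ∉ N.augmentable W.1 n, ∀ x, W'.1 x z = W.1 x z := by
  induction n generalizing y with
  | zero => exact ⟨W, .refl, fun _ => rfl, hy, fun _ _ _ => rfl⟩
  | succ n ih =>
    by_cases hyn : y ∈ N.augmentable W.1 n
    · obtain ⟨W', h₁, h₂, h₃, h₄⟩ := ih hyn
      exact ⟨W', h₁, h₂, h₃, fun z hz => h₄ z fun h => hz (Or.inl h)⟩
    · obtain ⟨x, z, hz, hxz, hpos⟩ := hy.resolve_left hyn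
      obtain ⟨W', h₁, h₂, h₃, h₄⟩ := ih hz
      have hyz : y ≠ z := fun h => hyn (h ▸ hz)
      obtain ⟨V, hV, hVW⟩ := hM.transfer x W' (fun _ => true) rfl y z hyz
        (by rw [h₄ y hyn x]; exact hpos) rfl ⟨hxz, h₃, rfl⟩
      refine ⟨V, h₁.tail ⟨x, hV⟩, fun u => ?_, ?_, fun u hu v => ?_⟩
      · have := congrArg (fun A => rowSum A u) hVW
        simp only [rowSum_add, rowSum_single] at this
        rw [← h₂ u]
        omega
      · have := congrArg (fun A => colSum A y) hVW
        simp only [colSum_add, colSum_single, if_neg hyz.symm, if_true] at this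
        have := W'.2.col_le y
        omega
      · have huy : y ≠ u := by
          rintro rfl
          exact hu (Or.inr ⟨x, z, hz, hxz, hpos⟩)
        have huz : z ≠ u := by
          rintro rfl
          exact hu (Or.inl hz)
        have := congrFun (congrFun hVW v) u
        simp only [Matrix.add_apply, Matrix.single_apply, huy, huz, and_false, if_false,
          add_zero] at this
        rw [this]
        exact h₄ u (fun h => hu (Or.inl h)) v

/-- While all units are on, the amount of allocated data can be increased as long as the
allocation is not complete. -/
theorem IsAdmissible.exists_totalSum_lt (hM : N.IsAdmissible M) (hN : N.ExistenceCondition)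
    {W : N.PartialAllocation} (hW : ¬ W.IsComplete) :
    ∃ W' : N.PartialAllocation,
      Relation.ReflTransGen (fun V V' => ∃ x, V' ∈ M x V fun _ => true) W W' ∧
      totalSum W.1 < totalSum W'.1 := by
  obtain ⟨x, y, n, hx, hxy, hy⟩ := hN.exists_adj_augmentable hW
  obtain ⟨W', h₁, h₂, h₃, -⟩ := hM.exists_colSum_lt W n hy
  obtain ⟨k, V, hV, hVW⟩ := hM.allocate x W' (fun _ => true) rfl (by rwa [h₂ x]) y ⟨hxy, h₃, rfl⟩
  -- Admissibility allows `n = 0` in its statement, but a modification must change the state.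
  have hk : 0 < k := by
    refine Nat.pos_of_ne_zero fun hk => (hM.subset x W' _ rfl V hV).ne (Subtype.ext ?_)
    rw [hVW, hk, Matrix.single_zero, add_zero]
  refine ⟨V, h₁.tail ⟨x, hV⟩, ?_⟩
  have hrow : ∀ u, rowSum V.1 u = rowSum W.1 u + if x = u then k else 0 := fun u => by
    rw [hVW, rowSum_add, rowSum_single, h₂ u]
  rw [totalSum_eq_sum_rowSum, totalSum_eq_sum_rowSum]
  refine Finset.sum_lt_sum (fun u _ => ?_) ⟨x, Finset.mem_univ x, ?_⟩
  · rw [hrow u]; exact Nat.le_add_right _ _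
  · rw [hrow x, if_pos rfl]; omega

theorem IsAdmissible.exists_isComplete (hM : N.IsAdmissible M) (hN : N.ExistenceCondition)
    (W : N.PartialAllocation) :
    ∃ W' : N.PartialAllocation,
      Relation.ReflTransGen (fun V V' => ∃ x, V' ∈ M x V fun _ => true) W W' ∧ W'.IsComplete := by
  induction hd : ∑ x, N.α x - totalSum W.1 using Nat.strong_induction_on generalizing W with
  | _ d ih =>
    by_cases hW : W.IsComplete
    · exact ⟨W, .refl, hW⟩
    · obtain ⟨V, hWV, hlt⟩ := hM.exists_totalSum_lt hN hW
      -- This bound makes the truncated difference, the induction measure, strictly decrease.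
      have hle : totalSum V.1 ≤ ∑ x, N.α x := Finset.sum_le_sum fun x _ => V.2.row_le x
      obtain ⟨W', hVW', hW'⟩ := ih (∑ x, N.α x - totalSum V.1) (by omega) V rfl
      exact ⟨W', hWV.trans hVW', hW'⟩

end Augmentation

/-! ### Signs, closedness and accessibility for the generator -/

section Generator

variable {X : Type*} [Fintype X] {N : StorageNetwork X} {U : X → N.PartialAllocation → ℝ} {γ : ℝ}
  {M : X → N.PartialAllocation → (X → Bool) → Finset N.PartialAllocation}

theorem partition_nonneg (x : X) (W : N.PartialAllocation) (ξ : X → Bool) :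
    0 ≤ N.partition U γ M x W ξ :=
  Finset.sum_nonneg fun _ _ => (Real.exp_pos _).le

theorem partition_pos {x : X} {W W' : N.PartialAllocation} {ξ : X → Bool} (h : W' ∈ M x W ξ) :
    0 < N.partition U γ M x W ξ :=
  Finset.sum_pos (fun _ _ => Real.exp_pos _) ⟨W', h⟩

theorem gibbsWeight_nonneg (x : X) (W : N.PartialAllocation) (ξ : X → Bool)
    (W' : N.PartialAllocation) : 0 ≤ N.gibbsWeight U γ M x W ξ W' := by
  unfold gibbsWeight
  split_ifs
  · exact div_nonneg (Real.exp_pos _).le (partition_nonneg _ _ _)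
  · exact div_nonneg (Real.exp_pos _).le (le_max_of_le_left (partition_nonneg _ _ _))

theorem gibbsWeight_pos {x : X} {W W' : N.PartialAllocation} {ξ : X → Bool} (h : W' ∈ M x W ξ) :
    0 < N.gibbsWeight U γ M x W ξ W' := by
  unfold gibbsWeight
  split_ifs
  · exact div_pos (Real.exp_pos _) (partition_pos h)
  · exact div_pos (Real.exp_pos _) (lt_max_of_lt_left (partition_pos h))

/-- Restricting to `W' ≠ W` avoids the remaining mass at `W`, which the generator discards as a
self-jump. -/
theorem activationProb_nonneg {x : X} {W W' : N.PartialAllocation} {ξ : X → Bool}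
    (h : W' ≠ W) : 0 ≤ N.activationProb U γ M x W ξ W' := by
  unfold activationProb
  rw [if_neg h]
  split_ifs
  · exact gibbsWeight_nonneg _ _ _ _
  · exact le_rfl

variable [DecidableEq X] {νon νoff νact : X → ℝ}

theorem generator_apply_of_ne {s s' : N.State} (h : s' ≠ s) :
    N.generator U γ M νon νoff νact s s' = N.rate U γ M νon νoff νact s s' :=
  if_neg h

theorem sum_generator_apply (s : N.State) : ∑ s', N.generator U γ M νon νoff νact s s' = 0 := by
  rw [← Finset.add_sum_erase _ _ (Finset.mem_univ s)]
  have h : ∑ u ∈ Finset.univ.erase s, N.generator U γ M νon νoff νact s u =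
      ∑ u ∈ Finset.univ.erase s, N.rate U γ M νon νoff νact s u :=
    Finset.sum_congr rfl fun u hu => generator_apply_of_ne (Finset.ne_of_mem_erase hu)
  rw [h]
  simp [generator]

/-- Only an activation can change the allocation, and modifications preserve completeness. -/
theorem generator_eq_zero (hM : N.IsAdmissible M) {s s' : N.State} (hs : s.1.IsComplete)
    (hs' : ¬ s'.1.IsComplete) : N.generator U γ M νon νoff νact s s' = 0 := by
  have hne : s'.1 ≠ s.1 := fun h => hs' (h ▸ hs)
  rw [generator_apply_of_ne fun h => hne (congrArg Prod.fst h)]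
  refine Finset.sum_eq_zero fun x _ => ?_
  have hact : s.2 x = true → N.activationProb U γ M x s.1 s.2 s'.1 = 0 := fun hx => by
    unfold activationProb
    rw [if_neg fun h => hs' ((hM.subset x s.1 s.2 hx s'.1 h).isComplete hs), if_neg hne]
  simp +contextual [hne, hact]

theorem rate_summand_nonneg (hon : ∀ x, 0 ≤ νon x) (hoff : ∀ x, 0 ≤ νoff x)
    (hact : ∀ x, 0 ≤ νact x) {s s' : N.State} (h : s' ≠ s) (x : X) :
    0 ≤ (if s.2 x = false ∧ s'.1 = s.1 ∧ s'.2 = Function.update s.2 x true then νon x else 0)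
      + (if s.2 x = true ∧ s'.1 = s.1 ∧ s'.2 = Function.update s.2 x false then νoff x else 0)
      + (if s.2 x = true ∧ s'.2 = s.2 then
          νact x * N.activationProb U γ M x s.1 s.2 s'.1 else 0) := by
  refine add_nonneg (add_nonneg ?_ ?_) ?_ <;> split_ifs with hx
  · exact hon x
  · exact le_rfl
  · exact hoff x
  · exact le_rfl
  · exact mul_nonneg (hact x) (activationProb_nonneg fun h₁ => h (Prod.ext h₁ hx.2))
  · exact le_rfl

theorem generator_nonneg (hon : ∀ x, 0 ≤ νon x) (hoff : ∀ x, 0 ≤ νoff x)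
    (hact : ∀ x, 0 ≤ νact x) {s s' : N.State} (h : s' ≠ s) :
    0 ≤ N.generator U γ M νon νoff νact s s' := by
  rw [generator_apply_of_ne h]
  exact Finset.sum_nonneg fun x _ => rate_summand_nonneg hon hoff hact h x

theorem generator_turnOn_pos (hon : ∀ x, 0 < νon x) (hoff : ∀ x, 0 ≤ νoff x)
    (hact : ∀ x, 0 ≤ νact x) (W : N.PartialAllocation) {ξ : X → Bool} {x : X}
    (hx : ξ x = false) :
    0 < N.generator U γ M νon νoff νact (W, ξ) (W, Function.update ξ x true) := by
  have hξ : Function.update ξ x true ≠ ξ := fun h => by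
    have := congrFun h x
    simp [hx] at this
  have hne : ((W, Function.update ξ x true) : N.State) ≠ (W, ξ) :=
    fun h => hξ (congrArg Prod.snd h)
  rw [generator_apply_of_ne hne]
  refine Finset.sum_pos' (fun z _ => rate_summand_nonneg (fun z => (hon z).le) hoff hact hne z)
    ⟨x, Finset.mem_univ x, ?_⟩
  simpa [hx] using hon x

theorem generator_activate_pos (hM : N.IsAdmissible M) (hon : ∀ x, 0 ≤ νon x)
    (hoff : ∀ x, 0 ≤ νoff x) (hact : ∀ x, 0 < νact x) {W W' : N.PartialAllocation}
    {ξ : X → Bool} {x : X} (hx : ξ x = true) (hW' : W' ∈ M x W ξ) :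
    0 < N.generator U γ M νon νoff νact (W, ξ) (W', ξ) := by
  have hne : ((W', ξ) : N.State) ≠ (W, ξ) :=
    fun h => (hM.subset x W ξ hx W' hW').ne (congrArg Prod.fst h)
  rw [generator_apply_of_ne hne]
  refine Finset.sum_pos' (fun z _ => rate_summand_nonneg hon hoff (fun z => (hact z).le) hne z)
    ⟨x, Finset.mem_univ x, ?_⟩
  -- Excludes the turn-off summand of `x`, leaving only its activation term.
  have hξ : ξ ≠ Function.update ξ x false := fun h => by
    have := congrFun h x
    simp [hx] at this
  have hpos : 0 < N.activationProb U γ M x W ξ W' := by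
    unfold activationProb
    rw [if_pos hW']
    exact gibbsWeight_pos hW'
  simpa [hx, hξ] using mul_pos (hact x) hpos

theorem reflTransGen_turnOn (hon : ∀ x, 0 < νon x) (hoff : ∀ x, 0 ≤ νoff x)
    (hact : ∀ x, 0 ≤ νact x) (W : N.PartialAllocation) (ξ : X → Bool) :
    Relation.ReflTransGen (fun s s' => 0 < N.generator U γ M νon νoff νact s s')
      (W, ξ) (W, fun _ => true) := by
  have h : ∀ T : Finset X,
      Relation.ReflTransGen (fun s s' => 0 < N.generator U γ M νon νoff νact s s')
        (W, ξ) (W, fun x => if x ∈ T then true else ξ x) := by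
    intro T
    induction T using Finset.induction_on with
    | empty => simpa using Relation.ReflTransGen.refl
    | insert a T _ ih =>
      set η : X → Bool := fun x => if x ∈ T then true else ξ x
      have hη : (fun x => if x ∈ insert a T then true else ξ x) = Function.update η a true := by
        funext x
        by_cases hx : x = a <;> simp [η, hx]
      rw [hη]
      cases ha : η a
      · exact ih.tail (generator_turnOn_pos hon hoff hact W ha)
      -- The unit is already on, so no jump is needed.
      · rwa [← ha, Function.update_eq_self]
  simpa using h Finset.univ

/-- Accessibility needs just one path of positive rates, so turn-offs may be ignored: once all units
are on, the path of activations keeps them on. -/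
theorem exists_isComplete_reflTransGen (hM : N.IsAdmissible M) (hN : N.ExistenceCondition)
    (hon : ∀ x, 0 < νon x) (hoff : ∀ x, 0 ≤ νoff x) (hact : ∀ x, 0 < νact x) (s : N.State) :
    ∃ s' : N.State, s'.1.IsComplete ∧
      Relation.ReflTransGen (fun s s' => 0 < N.generator U γ M νon νoff νact s s') s s' := by
  obtain ⟨W', hWW', hW'⟩ := hM.exists_isComplete hN s.1
  refine ⟨(W', fun _ => true), hW',
    (reflTransGen_turnOn hon hoff (fun x => (hact x).le) s.1 s.2).trans ?_⟩
  refine hWW'.lift (fun V => ((V, fun _ => true) : N.State)) ?_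
  rintro V V' ⟨x, hV'⟩
  exact generator_activate_pos hM (fun x => (hon x).le) hoff hact rfl hV'

end Generator

end StorageNetwork

theorem corollary4p3 {X : Type*} [Fintype X] [DecidableEq X] (N : StorageNetwork X)
    (hN : N.ExistenceCondition)
    (U : X → N.PartialAllocation → ℝ) (γ : ℝ) (hγ : 0 < γ)
    (M : X → N.PartialAllocation → (X → Bool) → Finset N.PartialAllocation)
    (hM : N.IsAdmissible M)
    (νon νoff νact : X → ℝ) (hon : ∀ x, 0 < νon x) (hoff : ∀ x, 0 ≤ νoff x)
    (hact : ∀ x, 0 < νact x)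
    {Ω : Type*} [MeasurableSpace Ω] (μ : Measure Ω) [IsProbabilityMeasure μ]
    (W : ℝ≥0 → Ω → N.PartialAllocation) (ξ : ℝ≥0 → Ω → X → Bool)
    (hWξ : IsContinuousTimeMarkovChain μ (N.generator U γ M νon νoff νact)
      (fun t ω => (W t ω, ξ t ω))) :
    ∀ᵐ ω ∂μ, ∃ t₀ : ℝ≥0, ∀ t ≥ t₀, (W t ω).IsComplete := by
  classical
  have h := hWξ.ae_eventually_mem (C := Finset.univ.filter fun s : N.State => s.1.IsComplete)
    (fun i j hij => StorageNetwork.generator_nonneg (fun x => (hon x).le) hoff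
      (fun x => (hact x).le) hij.symm)
    StorageNetwork.sum_generator_apply
    (fun i hi j hj => StorageNetwork.generator_eq_zero hM (by simpa using hi) (by simpa using hj))
    (fun s => by
      simpa using StorageNetwork.exists_isComplete_reflTransGen hM hN hon hoff hact s)
  simpa using h
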